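/- A cut in a linearly ordered set $I$ is a pair $(D,E)$ of nonempty subsets of $I$ with $I=D\cup E$ and $d<e$ for all $d\in D$, $e\in E$. It is principal if $D$ has a largest element or $E$ has a smallest element. Let $\kappa$ be the cofinality of $D$ and $\lambda$ the coinitiality of $E$ (the cofinality of $E$ under the reversed ordering). The cut is asymmetric if $\kappa\neq\lambda$, and strongly asymmetric if $\kappa\ne\lambda$ and at least one of $\kappa,\lambda$ is uncountable. The set $I$ is strongly symmetrically complete if every cut in $I$ is strongly asymmetric, and extremely symmetrically complete if in addition the coinitiality and the cofinality of $I$ are both uncountable. It is symmetrically d-complete if every nonprincipal cut in $I$ is asymmetric, and extremely symmetrically d-complete if in addition the cofinality of $I$ is uncountable. It is spherically complete with respect to the order balls if every nonempty chain (under inclusion) of closed bounded intervals $[a,b]$, $a\le b$, has a nonempty intersection. An ordered abelian group is said to have one of these properties if its underlying linearly ordered set does. An ordered abelian group is discretely ordered if it has a smallest positive element. A $\mathbb{Z}$-group is an ordered abelian group that has a convex subgroup isomorphic, as an ordered group, to $\mathbb{Z}$ such that the quotient by this subgroup is divisible. Theorem 1.9. Let $G$ be a discretely ordered abelian group, and identify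 $\mathbb{Z}$ with the convex subgroup of $G$ generated by the smallest positive element; $G/\mathbb{Z}$ carries the induced ordering. The following are equivalent: a) $G$ is symmetrically d-complete; b) $G$ is spherically complete with respect to the order balls; c) $G$ is a $\mathbb{Z}$-group and $G/\mathbb{Z}$ is strongly symmetrically complete. Further, $G$ is extremely symmetrically d-complete if and only if $G/\mathbb{Z}$ is extremely symmetrically complete. -/

import Mathlib

open scoped Cardinal

universe u

section LinearOrders

/-- A (Dedekind) cut in a linearly ordered set: both cut sets are nonempty. -/
structure OrderCut (I : Type u) [LinearOrder I] where
  lower : Set I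
  upper : Set I
  lower_nonempty : lower.Nonempty
  upper_nonempty : upper.Nonempty
  union_eq : lower ∪ upper = Set.univ
  lt_of_mem : ∀ d ∈ lower, ∀ e ∈ upper, d < e

namespace OrderCut

variable {I : Type u} [LinearOrder I]

/-- The first component of the cofinality of a cut: the cofinality of the lower cut set. -/
noncomputable def cf (C : OrderCut I) : Cardinal.{u} := Order.cof C.lower

/-- The second component of the cofinality of a cut: the coinitiality of the upper cut set,
that is, its cofinality under the reversed ordering. -/
noncomputable def ci (C : OrderCut I) : Cardinal.{u} := Order.cof (C.upper)ᵒᵈ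

/-- A cut is principal if its lower set has a maximum or its upper set has a minimum. -/
def IsPrincipal (C : OrderCut I) : Prop :=
  (∃ d, IsGreatest C.lower d) ∨ (∃ e, IsLeast C.upper e)

def IsAsymmetric (C : OrderCut I) : Prop := C.cf ≠ C.ci

def IsStronglyAsymmetric (C : OrderCut I) : Prop :=
  C.cf ≠ C.ci ∧ (ℵ₀ < C.cf ∨ ℵ₀ < C.ci)

end OrderCut

/-- Every cut is strongly asymmetric. -/
def StronglySymmetricallyComplete (I : Type u) [LinearOrder I] : Prop :=
  ∀ C : OrderCut I, C.IsStronglyAsymmetric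

/-- Strongly symmetrically complete, with uncountable coinitiality and cofinality. -/
def ExtremelySymmetricallyComplete (I : Type u) [LinearOrder I] : Prop :=
  StronglySymmetricallyComplete I ∧ ℵ₀ < Order.cof Iᵒᵈ ∧ ℵ₀ < Order.cof I

/-- Every nonprincipal cut is asymmetric. -/
def SymmetricallyDComplete (I : Type u) [LinearOrder I] : Prop :=
  ∀ C : OrderCut I, ¬ C.IsPrincipal → C.IsAsymmetric

/-- Every nonprincipal cut is asymmetric, and the cofinality is uncountable. -/
def ExtremelySymmetricallyDComplete (I : Type u) [LinearOrder I] : Prop :=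
  SymmetricallyDComplete I ∧ ℵ₀ < Order.cof I

/-- Spherical completeness with respect to the order balls: every nonempty chain of (nonempty)
closed bounded intervals has a nonempty intersection. -/
def OrderSphericallyComplete (I : Type u) [LinearOrder I] : Prop :=
  ∀ S : Set (Set I), S.Nonempty → (∀ s ∈ S, ∃ a b : I, a ≤ b ∧ s = Set.Icc a b) →
    IsChain (· ⊆ ·) S → (⋂₀ S).Nonempty

end LinearOrders

section OrderedGroups

variable {G : Type u} [AddCommGroup G] [LinearOrder G] [IsOrderedAddMonoid G]

theorem quotientClass_ordConnected (H : AddSubgroup G) [hH : (H : Set G).OrdConnected]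
    (x : Quotient (QuotientAddGroup.leftRel H)) :
    (Quotient.mk (QuotientAddGroup.leftRel H) ⁻¹' {x}).OrdConnected := by
  refine ⟨fun a ha b hb c hc => ?_⟩
  simp only [Set.mem_preimage, Set.mem_singleton_iff] at ha hb ⊢
  rw [← ha] at hb ⊢
  have h1 : -a + b ∈ H := QuotientAddGroup.leftRel_apply.1 (Quotient.exact hb.symm)
  refine (Quotient.sound (QuotientAddGroup.leftRel_apply.2 ?_)).symm
  refine hH.out H.zero_mem h1 ⟨?_, ?_⟩
  · rw [neg_add_eq_sub]; exact sub_nonneg.2 hc.1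
  · exact add_le_add_right hc.2 _

/-- The linear order on the quotient of an ordered abelian group by a convex subgroup. -/
noncomputable instance quotientLinearOrder (H : AddSubgroup G) [(H : Set G).OrdConnected] :
    LinearOrder (G ⧸ H) :=
  @Quotient.instLinearOrder G (QuotientAddGroup.leftRel H) _ (quotientClass_ordConnected H)
    (Classical.decRel _)

/-- The order on the quotient is the usual one. -/
theorem quotient_mk_le_mk_iff (H : AddSubgroup G) [(H : Set G).OrdConnected] (a b : G) :
    (QuotientAddGroup.mk a : G ⧸ H) ≤ QuotientAddGroup.mk b ↔ ∃ h ∈ H, a ≤ b + h := by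
  have := quotientClass_ordConnected H
  refine Iff.trans (Quotient.mk_le_mk (s := QuotientAddGroup.leftRel H) (x := a) (y := b)) ?_
  constructor
  · rintro (h | h)
    · exact ⟨0, H.zero_mem, by simpa using h⟩
    · have h' : -a + b ∈ H := QuotientAddGroup.leftRel_apply.1 h
      exact ⟨-(-a + b), H.neg_mem h', by simp⟩
  · rintro ⟨h, hh, hle⟩
    rcases le_total a b with hab | hba
    · exact Or.inl hab
    · refine Or.inr (QuotientAddGroup.leftRel_apply.2 ?_)
      have hH : (H : Set G).OrdConnected := inferInstance
      refine hH.out (H.neg_mem hh) H.zero_mem ⟨?_, ?_⟩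
      · rw [neg_add_eq_sub, neg_le_sub_iff_le_add]; exact hle
      · rw [neg_add_eq_sub]; exact sub_nonpos.2 hba

instance quotient_isOrderedAddMonoid (H : AddSubgroup G) [(H : Set G).OrdConnected] :
    IsOrderedAddMonoid (G ⧸ H) where
  add_le_add_left a b hab c := by
    induction a using QuotientAddGroup.induction_on with | H a
    induction b using QuotientAddGroup.induction_on with | H b
    induction c using QuotientAddGroup.induction_on with | H c
    obtain ⟨h, hh, hle⟩ := (quotient_mk_le_mk_iff H a b).1 hab
    refine (quotient_mk_le_mk_iff H (a + c) (b + c)).2 ⟨h, hh, ?_⟩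
    rw [add_right_comm]
    exact add_le_add_left hle c

variable (G) in
/-- An ordered abelian group is discretely ordered if it has a least positive element. -/
def IsDiscretelyOrdered : Prop := ∃ g : G, IsLeast {x : G | 0 < x} g

variable (G) in
/-- The copy of `ℤ` in a discretely ordered abelian group: the subgroup generated by the least
positive element. -/
def intSubgroup : AddSubgroup G := AddSubgroup.closure {g : G | IsLeast {x : G | 0 < x} g}

theorem intSubgroup_eq_zmultiples {g : G} (hg : IsLeast {x : G | 0 < x} g) :
    intSubgroup G = AddSubgroup.zmultiples g := by
  have : {g : G | IsLeast {x : G | 0 < x} g} = {g} :=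
    Set.eq_singleton_iff_unique_mem.2 ⟨hg, fun x hx => hx.unique hg⟩
  rw [intSubgroup, this, AddSubgroup.zmultiples_eq_closure]

instance intSubgroup_ordConnected : ((intSubgroup G : AddSubgroup G) : Set G).OrdConnected := by
  by_cases h : ∃ g : G, IsLeast {x : G | 0 < x} g
  · obtain ⟨g, hg⟩ := h
    rw [intSubgroup_eq_zmultiples hg]
    have key : ∀ k : ℕ, ∀ x : G, 0 ≤ x → x ≤ k • g → x ∈ AddSubgroup.zmultiples g := by
      intro k
      induction k with
      | zero =>
        intro x h0 h1
        rw [zero_nsmul] at h1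
        rw [le_antisymm h1 h0]
        exact AddSubgroup.zero_mem _
      | succ k ih =>
        intro x h0 h1
        rcases h0.eq_or_lt with h0 | h0
        · rw [← h0]
          exact AddSubgroup.zero_mem _
        · have h2 : x - g ∈ AddSubgroup.zmultiples g := by
            refine ih _ (sub_nonneg.2 (hg.2 h0)) ?_
            rw [sub_le_iff_le_add, ← succ_nsmul]
            exact h1
          have h3 := AddSubgroup.add_mem _ h2 (AddSubgroup.mem_zmultiples g)
          simpa using h3
    refine ⟨fun a ha b hb c hc => ?_⟩
    have hd : b - a ∈ AddSubgroup.zmultiples g := AddSubgroup.sub_mem _ hb ha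
    obtain ⟨n, hn⟩ := AddSubgroup.mem_zmultiples_iff.1 hd
    have hle : c - a ≤ n.toNat • g := by
      refine (sub_le_sub_right hc.2 a).trans ?_
      rw [← hn, ← natCast_zsmul]
      exact zsmul_le_zsmul_left hg.1.le (Int.self_le_toNat n)
    have h4 := AddSubgroup.add_mem _ (key _ _ (sub_nonneg.2 hc.1) hle) ha
    simpa using h4
  · have : {g : G | IsLeast {x : G | 0 < x} g} = ∅ :=
      Set.eq_empty_iff_forall_notMem.2 fun x hx => h ⟨x, hx⟩
    rw [intSubgroup, this, AddSubgroup.closure_empty, AddSubgroup.coe_bot]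
    exact Set.ordConnected_singleton

variable (G) in
/-- A `ℤ`-group: an ordered abelian group that has a convex subgroup `Z` isomorphic, as an ordered
group, to `ℤ`, such that the quotient by `Z` is divisible. -/
def IsOrderedZGroup : Prop :=
  ∃ Z : AddSubgroup G, (Z : Set G).OrdConnected ∧ Nonempty (ℤ ≃+o Z) ∧
    ∀ n : ℕ, n ≠ 0 → ∀ x : G ⧸ Z, ∃ y : G ⧸ Z, n • y = x

end OrderedGroups

/-! ### Cofinality of linear orders -/

section Cofinality

open Set

/-! Let `g` be the least positive element. The lower set of a nonprincipal cut in `G` is closed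
under adding `g`, so nonprincipal cuts are exactly the preimages of cuts in `G/ℤ`. Each fibre is a
copy of `ℤ`, so taking preimages turns cofinalities `κ, λ` into `max ℵ₀ κ, max ℵ₀ λ`; these differ
exactly when the cut below is strongly asymmetric. This links a) with the condition on `G/ℤ`, and
the same computation for the whole group gives the extremal version. A chain of intervals with empty
intersection defines a nonprincipal cut whose two sides are exhausted by the two ends of the same
chain, hence a symmetric one; conversely, a symmetric nonprincipal cut yields such a chain. This is
a) ⇔ b). Divisibility of `G/ℤ` is automatic: an element not divisible by `n` would give a cut `n • y
< x` that is symmetric under a reflection. -/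

theorem exists_strictMono_ord_cof_toType (α : Type u) [LinearOrder α] :
    ∃ f : (Order.cof α).ord.ToType → α, StrictMono f ∧ IsCofinal (range f) := by
  -- These are the record elements for an auxiliary well-order. On them both orders agree, so they
  -- form a well-ordered cofinal subset.
  let t : Set α := {a | ∀ b, WellOrderingRel b a → b < a}
  have ht : IsCofinal t := isCofinal_setOfPred_imp_lt WellOrderingRel
  have hwf : WellFoundedLT t := by
    refine ⟨Subrelation.wf (r := fun x y : t => WellOrderingRel x.1 y.1) ?_
      (InvImage.wf Subtype.val (IsWellFounded.wf (r := WellOrderingRel (α := α))))⟩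
    intro x y hxy
    rcases trichotomous_of (WellOrderingRel (α := α)) x.1 y.1 with h | h | h
    · exact h
    · exact absurd (Subtype.ext h) hxy.ne
    · exact absurd (x.2 _ h) hxy.not_gt
  obtain ⟨s, hs, hs'⟩ := Ordinal.exists_ord_cof_eq t
  rw [Order.cof_eq_of_isCofinal ht, ← Ordinal.type_toType (Order.cof α).ord] at hs'
  obtain ⟨e⟩ := Ordinal.type_eq.1 hs'.symm
  let e' := OrderIso.ofRelIsoLT e
  refine ⟨fun i => ((e' i).1 : t).1, fun i j hij => e'.strictMono hij, fun a => ?_⟩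
  obtain ⟨b, hb, hab⟩ := ht a
  obtain ⟨c, hc, hbc⟩ := hs ⟨b, hb⟩
  exact ⟨_, ⟨e'.symm ⟨c, hc⟩, by simp⟩, hab.trans hbc⟩

/-- If two families with a common index set are cofinal in their respective orders, and the order
of the second family controls that of the first, then the cofinalities compare. -/
theorem cof_le_cof_of_isCofinal_range {ι : Type*} {α β : Type u} [LinearOrder α] [LinearOrder β]
    [NoMaxOrder β] {a : ι → α} {b : ι → β} (ha : IsCofinal (range a)) (hb : IsCofinal (range b))
    (h : ∀ i j, b i < b j → a i ≤ a j) : Order.cof α ≤ Order.cof β := by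
  rw [Order.le_cof_iff]
  intro s hs
  have key : ∀ x : s, ∃ j, x.1 < b j := fun x => by
    obtain ⟨y, hy⟩ := exists_gt x.1
    obtain ⟨_, ⟨j, rfl⟩, hj⟩ := hb y
    exact ⟨j, hy.trans_le hj⟩
  choose j hj using key
  refine (Order.cof_le (s := range fun x => a (j x)) fun x => ?_).trans Cardinal.mk_range_le
  obtain ⟨_, ⟨i, rfl⟩, hi⟩ := ha x
  obtain ⟨y, hy, hiy⟩ := hs (b i)
  exact ⟨_, ⟨⟨y, hy⟩, rfl⟩, hi.trans (h _ _ (hiy.trans_lt (hj ⟨y, hy⟩)))⟩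

/-- The cofinality of the total space of a monotone surjection whose fibres have countable
cofinality. -/
theorem cof_eq_max_of_surjective {α β : Type u} [LinearOrder α] [LinearOrder β] [Nonempty α]
    [NoMaxOrder α] {f : α → β} (hf : Monotone f) (hf' : Function.Surjective f)
    (hfib : ∀ a, ∃ s : ℕ → α, ∀ x, f x = f a → ∃ n, x ≤ s n) :
    Order.cof α = max ℵ₀ (Order.cof β) := by
  have hinf : ℵ₀ ≤ Order.cof α := Order.aleph0_le_cof
  -- Over a top element, the countable sequence in its fibre is already cofinal. Without one, `f`
  -- itself compares the two orders.
  by_cases hB : ∃ t : β, IsTop t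
  · rw [Order.cof_eq_one_iff.2 hB, max_eq_left Cardinal.one_le_aleph0]
    obtain ⟨t, ht⟩ := hB
    obtain ⟨a, rfl⟩ := hf' t
    obtain ⟨s, hs⟩ := hfib a
    refine le_antisymm ((Order.cof_le (s := range s ∪ {a}) fun x => ?_).trans
      ((countable_range s).union (countable_singleton a)).le_aleph0) hinf
    rcases (ht (f x)).eq_or_lt with h | h
    · obtain ⟨n, hn⟩ := hs x h
      exact ⟨s n, Or.inl ⟨n, rfl⟩, hn⟩
    · exact ⟨a, Or.inr rfl, (hf.reflect_lt h).le⟩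
  · have : NoMaxOrder β := ⟨fun b => by
      by_contra! h
      exact hB ⟨b, h⟩⟩
    have hid : IsCofinal (range (id : α → α)) := by simp
    have hfr : IsCofinal (range f) := by simp [hf'.range_eq]
    have h1 := cof_le_cof_of_isCofinal_range hid hfr fun i j h => (hf.reflect_lt h).le
    have h2 := cof_le_cof_of_isCofinal_range hfr hid fun i j h => hf h.le
    rw [max_eq_right (hinf.trans h1)]
    exact le_antisymm h1 h2

theorem max_aleph0_cof_ne_iff (α β : Type u) [LinearOrder α] [LinearOrder β] [Nonempty α]
    [Nonempty β] : max ℵ₀ (Order.cof α) ≠ max ℵ₀ (Order.cof β) ↔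
      Order.cof α ≠ Order.cof β ∧ (ℵ₀ < Order.cof α ∨ ℵ₀ < Order.cof β) := by
  constructor
  · intro h
    refine ⟨fun h' => h (by rw [h']), ?_⟩
    by_contra! h'
    exact h (by rw [max_eq_left h'.1, max_eq_left h'.2])
  · rintro ⟨hne, h | h⟩ heq
    · rw [max_eq_right h.le] at heq
      rcases max_choice ℵ₀ (Order.cof β) with h' | h'
      · exact h.ne' (heq.trans h')
      · exact hne (heq.trans h')
    · rw [max_eq_right h.le] at heq
      rcases max_choice ℵ₀ (Order.cof α) with h' | h'
      · exact h.ne' (heq.symm.trans h')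
      · exact hne (h'.symm.trans heq)

end Cofinality

/-! ### Order balls and symmetric cuts -/

section OrderBalls

open Set

variable {I : Type u} [LinearOrder I]

theorem SymmetricallyDComplete.orderSphericallyComplete (hI : SymmetricallyDComplete I) :
    OrderSphericallyComplete I := by
  intro S hS hball hchain
  by_contra hemp
  have hemp : ∀ x, ∃ s ∈ S, x ∉ s := by
    intro x
    by_contra! h
    exact hemp ⟨x, h⟩
  let J := {p : I × I // p.1 ≤ p.2 ∧ Icc p.1 p.2 ∈ S}
  have hcases : ∀ p q : J, (p.1.1 ≤ q.1.1 ∧ q.1.2 ≤ p.1.2) ∨ (q.1.1 ≤ p.1.1 ∧ p.1.2 ≤ q.1.2) := by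
    intro p q
    rcases hchain.total q.2.2 p.2.2 with h | h
    · exact Or.inl ((Icc_subset_Icc_iff q.2.1).1 h)
    · exact Or.inr ((Icc_subset_Icc_iff p.2.1).1 h)
  have hle : ∀ p q : J, p.1.1 ≤ q.1.2 := by
    intro p q
    rcases hcases p q with h | h
    · exact h.1.trans q.2.1
    · exact p.2.1.trans h.2
  have hout : ∀ x, ∃ p : J, ¬ (p.1.1 ≤ x ∧ x ≤ p.1.2) := by
    intro x
    obtain ⟨s, hs, hx⟩ := hemp x
    obtain ⟨a, b, hab, rfl⟩ := hball s hs
    exact ⟨⟨(a, b), hab, hs⟩, hx⟩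
  obtain ⟨p₀⟩ : Nonempty J := by
    obtain ⟨s, hs⟩ := hS
    obtain ⟨a, b, hab, rfl⟩ := hball s hs
    exact ⟨⟨(a, b), hab, hs⟩⟩
  -- Left endpoints generate the lower set, right endpoints the upper set. The empty intersection
  -- gives both that they cover `I` and that neither side attains its bound.
  let C : OrderCut I :=
    { lower := {x | ∃ p : J, x ≤ p.1.1}
      upper := {x | ∃ p : J, p.1.2 ≤ x}
      lower_nonempty := ⟨_, p₀, le_rfl⟩
      upper_nonempty := ⟨_, p₀, le_rfl⟩
      union_eq := by
        refine eq_univ_of_forall fun x => ?_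
        obtain ⟨p, hp⟩ := hout x
        rcases lt_or_ge x p.1.1 with h | h
        · exact Or.inl ⟨p, h.le⟩
        · exact Or.inr ⟨p, (not_le.1 fun h' => hp ⟨h, h'⟩).le⟩
      lt_of_mem := by
        rintro d ⟨p, hp⟩ e ⟨q, hq⟩
        refine lt_of_le_of_ne (hp.trans ((hle p q).trans hq)) ?_
        rintro rfl
        obtain ⟨r, hr⟩ := hout d
        exact hr ⟨(hle r q).trans hq, hp.trans (hle p r)⟩ }
  have hlow : ∀ d, ¬ IsGreatest C.lower d := by
    rintro d ⟨⟨p, hp⟩, hd⟩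
    obtain ⟨r, hr⟩ := hout d
    exact hr ⟨hd ⟨r, le_rfl⟩, hp.trans (hle p r)⟩
  have hupp : ∀ e, ¬ IsLeast C.upper e := by
    rintro e ⟨⟨p, hp⟩, he⟩
    obtain ⟨r, hr⟩ := hout e
    exact hr ⟨(hle r p).trans hp, he ⟨r, le_rfl⟩⟩
  refine hI C (by rintro (⟨d, hd⟩ | ⟨e, he⟩); exacts [hlow d hd, hupp e he]) ?_
  have : NoMaxOrder C.lower := ⟨fun d => by
    by_contra! h
    exact hlow d ⟨d.2, fun x hx => h ⟨x, hx⟩⟩⟩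
  have : NoMinOrder C.upper := ⟨fun e => by
    by_contra! h
    exact hupp e ⟨e.2, fun x hx => h ⟨x, hx⟩⟩⟩
  let a : J → C.lower := fun p => ⟨p.1.1, p, le_rfl⟩
  let b : J → (C.upper)ᵒᵈ := fun p => OrderDual.toDual ⟨p.1.2, p, le_rfl⟩
  have ha : IsCofinal (range a) := by
    rintro ⟨x, p, hp⟩
    exact ⟨_, ⟨p, rfl⟩, hp⟩
  have hb : IsCofinal (range b) := by
    rintro ⟨x, p, hp⟩
    exact ⟨_, ⟨p, rfl⟩, hp⟩
  refine le_antisymm (cof_le_cof_of_isCofinal_range ha hb fun p q h => ?_)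
    (cof_le_cof_of_isCofinal_range hb ha fun p q h => ?_)
  -- By nesting, a strictly smaller right endpoint forces a left endpoint at least as large.
  · have h : q.1.2 < p.1.2 := h
    rcases hcases p q with h' | h'
    · exact h'.1
    · exact absurd h'.2 h.not_ge
  · have h : p.1.1 < q.1.1 := h
    rcases hcases p q with h' | h'
    · exact h'.2
    · exact absurd h'.1 h.not_ge

theorem OrderSphericallyComplete.symmetricallyDComplete (hI : OrderSphericallyComplete I) :
    SymmetricallyDComplete I := by
  intro C hC heq
  have hex := exists_strictMono_ord_cof_toType C.lower
  -- Symmetry lets both cofinal sequences share one index type, so that they pair up as nested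
  -- intervals.
  rw [show Order.cof C.lower = Order.cof (C.upper)ᵒᵈ from heq] at hex
  obtain ⟨f, hf, hf'⟩ := hex
  obtain ⟨g, hg, hg'⟩ := exists_strictMono_ord_cof_toType (C.upper)ᵒᵈ
  obtain ⟨d₀, hd₀⟩ := C.lower_nonempty
  obtain ⟨_, ⟨i₀, rfl⟩, -⟩ := hf' ⟨d₀, hd₀⟩
  obtain ⟨x, hx⟩ := hI (range fun i => Icc (f i).1 (OrderDual.ofDual (g i)).1)
    ⟨_, i₀, rfl⟩ (by
      rintro _ ⟨i, rfl⟩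
      exact ⟨_, _, (C.lt_of_mem _ (f i).2 _ (OrderDual.ofDual (g i)).2).le, rfl⟩) (by
      rintro _ ⟨i, rfl⟩ _ ⟨j, rfl⟩ -
      rcases le_total i j with h | h
      · exact Or.inr (Icc_subset_Icc (hf.monotone h) (hg.monotone h))
      · exact Or.inl (Icc_subset_Icc (hf.monotone h) (hg.monotone h)))
  have hx : ∀ i, (f i).1 ≤ x ∧ x ≤ (OrderDual.ofDual (g i)).1 := fun i => hx _ ⟨i, rfl⟩
  have hxC : x ∈ C.lower ∪ C.upper := by rw [C.union_eq]; trivial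
  refine hC (hxC.imp (fun h => ⟨x, h, fun d hd => ?_⟩) fun h => ⟨x, h, fun e he => ?_⟩)
  · obtain ⟨_, ⟨i, rfl⟩, hi⟩ := hf' ⟨d, hd⟩
    exact le_trans hi (hx i).1
  · obtain ⟨_, ⟨i, rfl⟩, hi⟩ := hg' (OrderDual.toDual ⟨e, he⟩)
    exact (hx i).2.trans hi

theorem symmetricallyDComplete_iff_orderSphericallyComplete :
    SymmetricallyDComplete I ↔ OrderSphericallyComplete I :=
  ⟨SymmetricallyDComplete.orderSphericallyComplete,
    OrderSphericallyComplete.symmetricallyDComplete⟩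

end OrderBalls

/-! ### Divisibility from asymmetry -/

section Divisibility

open Set

variable {H : Type u} [AddCommGroup H] [LinearOrder H] [IsOrderedAddMonoid H]

theorem exists_nsmul_eq_of_forall_isAsymmetric (hH : ∀ C : OrderCut H, C.IsAsymmetric)
    {n : ℕ} (hn : n ≠ 0) (x : H) : ∃ y, n • y = x := by
  obtain ⟨m, rfl⟩ := Nat.exists_eq_succ_of_ne_zero hn
  induction m generalizing x with
  | zero => exact ⟨x, by simp⟩
  | succ k ih =>
    set m := k + 1 with hm
    have hm0 : m ≠ 0 := Nat.succ_ne_zero k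
    by_contra! hx
    have hle : ∀ z : H, 0 ≤ z → z ≤ (m + 1) • z := fun z hz => by
      rw [succ_nsmul]
      exact le_add_of_nonneg_left (nsmul_nonneg hz m)
    -- The map `y ↦ x - m • y` would fix a solution of `(m + 1) • y = x`; here it swaps the sides of
    -- the cut.
    have hrefl : ∀ y : H, (m + 1) • (x - m • y) = x + m • (x - (m + 1) • y) := fun y => by
      module
    let C : OrderCut H :=
      { lower := {y | (m + 1) • y < x}
        upper := {y | x < (m + 1) • y}
        lower_nonempty := by
          refine ⟨-|x|, lt_of_le_of_ne ?_ (hx _)⟩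
          rw [smul_neg]
          exact (neg_le_neg (hle _ (abs_nonneg x))).trans (neg_abs_le x)
        upper_nonempty :=
          ⟨|x|, lt_of_le_of_ne ((le_abs_self x).trans (hle _ (abs_nonneg x))) (hx _).symm⟩
        union_eq := eq_univ_of_forall fun y => lt_or_gt_of_ne (hx y)
        lt_of_mem := fun d hd e he => lt_of_nsmul_lt_nsmul_right (m + 1) (lt_trans hd he) }
    let f : C.lower → (C.upper)ᵒᵈ := fun y => OrderDual.toDual ⟨x - m • y.1, by
      change x < _
      rw [hrefl]
      exact lt_add_of_pos_right _ (nsmul_pos (sub_pos.2 y.2) hm0)⟩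
    refine hH C (Order.cof_congr_of_strictMono (f := f) (fun y z hyz => ?_) fun e => ?_)
    · change x - m • z.1 < x - m • y.1
      exact sub_lt_sub_left (nsmul_lt_nsmul_right hm0 (show y.1 < z.1 from hyz)) x
    · obtain ⟨⟨e, he⟩, rfl⟩ := OrderDual.toDual.surjective e
      -- Divisibility by `m` makes the reflection onto, hence cofinal.
      obtain ⟨d, hd⟩ := ih (x - e) hm0
      have hd' : x - m • d = e := by rw [hd, sub_sub_cancel]
      have hdlow : (m + 1) • d < x := by
        have h : x < (m + 1) • e := he
        rw [← hd', hrefl] at h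
        by_contra! hcon
        exact h.not_ge (add_le_of_nonpos_right (nsmul_nonpos (sub_nonpos.2 hcon) m))
      exact ⟨_, ⟨⟨d, hdlow⟩, rfl⟩, by change x - m • d ≤ e; exact hd'.le⟩

end Divisibility

/-! ### Cuts in `G` and in `G/ℤ` -/

section Quotient

open Set
open scoped Pointwise

variable {G : Type u} [AddCommGroup G] [LinearOrder G] [IsOrderedAddMonoid G]

theorem cof_dual_set_eq_cof_neg (S : Set G) : Order.cof Sᵒᵈ = Order.cof (-S : Set G) := by
  refine Order.cof_congr_of_strictMono
    (f := fun x : Sᵒᵈ => (⟨-(OrderDual.ofDual x).1, by simp⟩ : (-S : Set G)))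
    (fun x y hxy => ?_) fun y => ?_
  · change -(OrderDual.ofDual x).1 < -(OrderDual.ofDual y).1
    exact neg_lt_neg hxy
  · exact ⟨_, ⟨OrderDual.toDual ⟨-y.1, y.2⟩, rfl⟩, by change y.1 ≤ - -y.1; rw [neg_neg]⟩

theorem quotient_mk_monotone (H : AddSubgroup G) [(H : Set G).OrdConnected] :
    Monotone (QuotientAddGroup.mk : G → G ⧸ H) := fun a b hab =>
  (quotient_mk_le_mk_iff H a b).2 ⟨0, H.zero_mem, by simpa using hab⟩

theorem quotient_mk_intSubgroup_eq_iff {g : G} (hg : IsLeast {x : G | 0 < x} g) {x y : G} :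
    (x : G ⧸ intSubgroup G) = y ↔ ∃ k : ℤ, y = x + k • g := by
  rw [QuotientAddGroup.eq, intSubgroup_eq_zmultiples hg, AddSubgroup.mem_zmultiples_iff]
  refine exists_congr fun k => ?_
  rw [eq_neg_add_iff_add_eq, eq_comm]

/-- Each fibre is a coset `a + ℤ • g`, in which the `a + n • g` with `n : ℕ` are cofinal. -/
theorem cof_preimage_quotient_mk {g : G} (hg : IsLeast {x : G | 0 < x} g)
    {S : Set (G ⧸ intSubgroup G)} (hS : S.Nonempty) :
    Order.cof ((QuotientAddGroup.mk : G → G ⧸ intSubgroup G) ⁻¹' S) = max ℵ₀ (Order.cof S) := by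
  set π : G → G ⧸ intSubgroup G := QuotientAddGroup.mk
  have hmem : ∀ x (k : ℤ), π (x + k • g) = π x := fun x k =>
    ((quotient_mk_intSubgroup_eq_iff hg).2 ⟨k, rfl⟩).symm
  have : Nonempty (π ⁻¹' S) := by
    obtain ⟨s, hs⟩ := hS
    obtain ⟨a, rfl⟩ := QuotientAddGroup.mk_surjective s
    exact ⟨⟨a, hs⟩⟩
  have : NoMaxOrder (π ⁻¹' S) := ⟨fun x => ⟨⟨x.1 + (1 : ℤ) • g, by
    rw [mem_preimage, hmem]; exact x.2⟩, by
      change x.1 < x.1 + (1 : ℤ) • g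
      rw [one_zsmul]
      exact lt_add_of_pos_right _ hg.1⟩⟩
  refine cof_eq_max_of_surjective (f := fun x : π ⁻¹' S => (⟨π x.1, x.2⟩ : S))
    (fun x y hxy => quotient_mk_monotone _ hxy) ?_ fun a => ?_
  · rintro ⟨s, hs⟩
    obtain ⟨a, rfl⟩ := QuotientAddGroup.mk_surjective s
    exact ⟨⟨a, hs⟩, rfl⟩
  · refine ⟨fun n => ⟨a.1 + (n : ℤ) • g, by rw [mem_preimage, hmem]; exact a.2⟩, fun x hx => ?_⟩
    obtain ⟨k, hk⟩ := (quotient_mk_intSubgroup_eq_iff hg).1 (congrArg Subtype.val hx).symm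
    refine ⟨k.toNat, ?_⟩
    change x.1 ≤ a.1 + (k.toNat : ℤ) • g
    rw [hk]
    exact add_le_add_right (zsmul_le_zsmul_left hg.1.le (Int.self_le_toNat k)) _

theorem cof_preimage_quotient_mk_dual {g : G} (hg : IsLeast {x : G | 0 < x} g)
    {S : Set (G ⧸ intSubgroup G)} (hS : S.Nonempty) :
    Order.cof ((QuotientAddGroup.mk : G → G ⧸ intSubgroup G) ⁻¹' S)ᵒᵈ =
      max ℵ₀ (Order.cof Sᵒᵈ) := by
  rw [cof_dual_set_eq_cof_neg, cof_dual_set_eq_cof_neg, ← cof_preimage_quotient_mk hg hS.neg]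
  rfl

/-- The preimage in `G` of a cut in the quotient by a convex subgroup. -/
def OrderCut.comapQuotient {H : AddSubgroup G} [(H : Set G).OrdConnected]
    (C : OrderCut (G ⧸ H)) : OrderCut G where
  lower := (QuotientAddGroup.mk : G → G ⧸ H) ⁻¹' C.lower
  upper := (QuotientAddGroup.mk : G → G ⧸ H) ⁻¹' C.upper
  lower_nonempty := C.lower_nonempty.preimage QuotientAddGroup.mk_surjective
  upper_nonempty := C.upper_nonempty.preimage QuotientAddGroup.mk_surjective
  union_eq := by rw [← preimage_union, C.union_eq, preimage_univ]
  lt_of_mem d hd e he := (quotient_mk_monotone H).reflect_lt (C.lt_of_mem _ hd _ he)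

theorem OrderCut.isAsymmetric_comapQuotient_iff (hG : IsDiscretelyOrdered G)
    (C : OrderCut (G ⧸ intSubgroup G)) : C.comapQuotient.IsAsymmetric ↔ C.IsStronglyAsymmetric := by
  obtain ⟨g, hg⟩ := hG
  have := C.lower_nonempty.to_subtype
  have := C.upper_nonempty.to_subtype
  have h := max_aleph0_cof_ne_iff C.lower (C.upper)ᵒᵈ
  rw [← cof_preimage_quotient_mk hg C.lower_nonempty,
    ← cof_preimage_quotient_mk_dual hg C.upper_nonempty] at h
  exact h

theorem OrderCut.not_isPrincipal_comapQuotient (hG : IsDiscretelyOrdered G)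
    (C : OrderCut (G ⧸ intSubgroup G)) : ¬ C.comapQuotient.IsPrincipal := by
  obtain ⟨g, hg⟩ := hG
  rintro (⟨d, hd, hd'⟩ | ⟨e, he, he'⟩)
  · have h : d + g ∈ C.comapQuotient.lower := by
      change _ ∈ C.lower
      rwa [← (quotient_mk_intSubgroup_eq_iff hg (x := d)).2 ⟨1, by simp⟩]
    exact (hd' h).not_gt (lt_add_of_pos_right d hg.1)
  · have h : e - g ∈ C.comapQuotient.upper := by
      change _ ∈ C.upper
      rwa [← (quotient_mk_intSubgroup_eq_iff hg (x := e)).2 ⟨-1, by simp [sub_eq_add_neg]⟩]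
    exact (he' h).not_gt (sub_lt_self e hg.1)

theorem OrderCut.exists_comapQuotient_eq (hG : IsDiscretelyOrdered G) (C : OrderCut G)
    (hC : ¬ C.IsPrincipal) : ∃ C' : OrderCut (G ⧸ intSubgroup G), C'.comapQuotient = C := by
  obtain ⟨g, hg⟩ := hG
  have hor : ∀ x, x ∈ C.lower ∨ x ∈ C.upper := fun x => by
    have : x ∈ C.lower ∪ C.upper := by rw [C.union_eq]; trivial
    exact this
  have hadd : ∀ x ∈ C.lower, x + g ∈ C.lower := by
    intro x hx
    -- Nothing lies strictly between `x` and `x + g`, so if `x + g` were in the upper set, `x` would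
    -- be the maximum of the lower one.
    refine (hor _).resolve_right fun hxg => hC (Or.inl ⟨x, hx, fun y hy => ?_⟩)
    have h1 := C.lt_of_mem y hy _ hxg
    by_contra! h2
    have h3 := hg.2 (sub_pos.2 h2)
    rw [le_sub_iff_add_le'] at h3
    exact h3.not_gt h1
  have hnat : ∀ n : ℕ, ∀ x ∈ C.lower, x + n • g ∈ C.lower := by
    intro n x hx
    induction n with
    | zero => simpa using hx
    | succ n ih => rw [succ_nsmul, ← add_assoc]; exact hadd _ ih
  have hdown : ∀ x ∈ C.lower, ∀ y ≤ x, y ∈ C.lower := fun x hx y hy =>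
    (hor y).resolve_right fun h => (C.lt_of_mem x hx y h).not_ge hy
  have hsat : ∀ x ∈ C.lower, ∀ y : G, (x : G ⧸ intSubgroup G) = y → y ∈ C.lower := by
    intro x hx y hxy
    obtain ⟨k, rfl⟩ := (quotient_mk_intSubgroup_eq_iff hg).1 hxy
    refine hdown _ (hnat k.toNat x hx) _ (add_le_add_right ?_ _)
    rw [← natCast_zsmul]
    exact zsmul_le_zsmul_left hg.1.le (Int.self_le_toNat k)
  have hdisj : ∀ x ∈ C.lower, x ∉ C.upper := fun x hx hx' => (C.lt_of_mem x hx x hx').false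
  let π : G → G ⧸ intSubgroup G := QuotientAddGroup.mk
  have hlow : π ⁻¹' (π '' C.lower) = C.lower :=
    (subset_preimage_image _ _).antisymm' fun y ⟨x, hx, hxy⟩ => hsat x hx y hxy
  have hupp : π ⁻¹' (π '' C.upper) = C.upper :=
    (subset_preimage_image _ _).antisymm' fun y ⟨x, hx, hxy⟩ =>
      (hor y).resolve_left fun hy => hdisj x (hsat y hy x hxy.symm) hx
  let C' : OrderCut (G ⧸ intSubgroup G) :=
    { lower := π '' C.lower
      upper := π '' C.upper
      lower_nonempty := C.lower_nonempty.image π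
      upper_nonempty := C.upper_nonempty.image π
      union_eq := by
        rw [← image_union, C.union_eq, image_univ]
        exact QuotientAddGroup.mk_surjective.range_eq
      lt_of_mem := by
        rintro _ ⟨d, hd, rfl⟩ _ ⟨e, he, rfl⟩
        exact lt_of_le_of_ne (quotient_mk_monotone _ (C.lt_of_mem d hd e he).le)
          fun h => hdisj e (hsat d hd e h) he }
  refine ⟨C', ?_⟩
  cases C
  simp only [OrderCut.comapQuotient, OrderCut.mk.injEq]
  exact ⟨hlow, hupp⟩

theorem symmetricallyDComplete_iff_stronglySymmetricallyComplete_quotient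
    (hG : IsDiscretelyOrdered G) :
    SymmetricallyDComplete G ↔ StronglySymmetricallyComplete (G ⧸ intSubgroup G) := by
  constructor
  · intro h C
    exact (C.isAsymmetric_comapQuotient_iff hG).1 (h _ (C.not_isPrincipal_comapQuotient hG))
  · intro h C hC
    obtain ⟨C', rfl⟩ := C.exists_comapQuotient_eq hG hC
    exact (C'.isAsymmetric_comapQuotient_iff hG).2 (h C')

theorem nonempty_orderAddMonoidIso_intSubgroup (hG : IsDiscretelyOrdered G) :
    Nonempty (ℤ ≃+o intSubgroup G) := by
  obtain ⟨g, hg⟩ := hG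
  rw [intSubgroup_eq_zmultiples hg]
  have hmono : StrictMono fun k : ℤ => k • g := zsmul_left_strictMono hg.1
  let f : ℤ →+ AddSubgroup.zmultiples g :=
    (zmultiplesHom G g).codRestrict _ fun k => AddSubgroup.mem_zmultiples_iff.2 ⟨k, rfl⟩
  have hf : Function.Bijective f := by
    refine ⟨fun a b hab => hmono.injective (congrArg Subtype.val hab), ?_⟩
    rintro ⟨x, hx⟩
    obtain ⟨k, rfl⟩ := AddSubgroup.mem_zmultiples_iff.1 hx
    exact ⟨k, rfl⟩
  exact ⟨{ AddEquiv.ofBijective f hf with map_le_map_iff' := fun {a b} => hmono.le_iff_le }⟩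

theorem isOrderedZGroup_of_stronglySymmetricallyComplete_quotient (hG : IsDiscretelyOrdered G)
    (h : StronglySymmetricallyComplete (G ⧸ intSubgroup G)) : IsOrderedZGroup G :=
  ⟨intSubgroup G, inferInstance, nonempty_orderAddMonoidIso_intSubgroup hG, fun _ hn x =>
    exists_nsmul_eq_of_forall_isAsymmetric (fun C => (h C).1) hn x⟩

theorem aleph0_lt_cof_iff_quotient (hG : IsDiscretelyOrdered G) :
    ℵ₀ < Order.cof G ↔ ℵ₀ < Order.cof (G ⧸ intSubgroup G) := by
  obtain ⟨g, hg⟩ := hG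
  have h := cof_preimage_quotient_mk hg (S := univ) univ_nonempty
  rw [preimage_univ, (OrderIso.Set.univ (α := G)).cof_congr,
    (OrderIso.Set.univ (α := G ⧸ intSubgroup G)).cof_congr] at h
  rw [h, lt_max_iff, or_iff_right (lt_irrefl _)]

theorem cof_dual_eq_cof : Order.cof Gᵒᵈ = Order.cof G :=
  (OrderIso.neg G).symm.cof_congr

end Quotient

theorem theorem1p9 {G : Type*} [AddCommGroup G] [LinearOrder G] [IsOrderedAddMonoid G]
    (hG : IsDiscretelyOrdered G) :
    List.TFAE
      [SymmetricallyDComplete G,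
       OrderSphericallyComplete G,
       IsOrderedZGroup G ∧ StronglySymmetricallyComplete (G ⧸ intSubgroup G)] ∧
    (ExtremelySymmetricallyDComplete G ↔
      ExtremelySymmetricallyComplete (G ⧸ intSubgroup G)) := by
  have hquot := symmetricallyDComplete_iff_stronglySymmetricallyComplete_quotient hG
  constructor
  · tfae_have 1 ↔ 2 := symmetricallyDComplete_iff_orderSphericallyComplete
    tfae_have 1 → 3 := fun h =>
      ⟨isOrderedZGroup_of_stronglySymmetricallyComplete_quotient hG (hquot.1 h), hquot.1 h⟩
    tfae_have 3 → 1 := fun h => hquot.2 h.2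
    tfae_finish
  -- Negation merges the coinitiality and cofinality conditions on the quotient into one.
  · rw [ExtremelySymmetricallyDComplete, ExtremelySymmetricallyComplete, cof_dual_eq_cof,
      and_self, hquot, aleph0_lt_cof_iff_quotient hG]
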